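/- Let $n\ge 0$, let $K$ be a field, and let $c=(c_m)_{m\in\mathbb{Z}}$ be a sequence of elements of $K$ with $c_m=0$ for all $m<0$. Put $$(y|c)^k=(y-c_0)(y-c_1)\cdots(y-c_{k-1})\quad(k\ge 0),\qquad (\tau^r c)_m=c_{m+r}\quad(r\in\mathbb{Z}).$$ For any sequence $a=(a_m)_{m\in\mathbb{Z}}$ in $K$ and any $k\ge 0$, the complete factorial symmetric polynomial in $N\ge 1$ variables is $$h_k(y_1,\dots,y_N|a)=\frac{\det\big[(y_i|a)^{\mu_j+N-j}\big]_{i,j=1}^N}{\det\big[(y_i|a)^{N-j}\big]_{i,j=1}^N},\qquad \mu=(k,0,\dots,0),$$ which is a polynomial in $y_1,\dots,y_N$, and $h_k(y_1,\dots,y_N|a)=0$ for $k<0$. Let $\lambda=(\lambda_1\ge\dots\ge\lambda_n\ge 0)$ be a partition, and let $x_1,\dots,x_n$ be nonzero elements of $K$ with chosen square roots $x_i^{1/2}\in K$ such that $x_i\ne 1$ for all $i$ and $x_i\ne x_j$, $x_i\neq x_j^{-1}$ for all $i\ne j$ (for example, $K$ may be a field of rational functions in which the $x_i^{1/2}$ are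 indeterminates). Write $\overline{x}_i=x_i^{-1}$ and $\overline{x}_i^{1/2}=(x_i^{1/2})^{-1}$. Then the denominator of the factorial odd orthogonal character $$\mathrm{so}_\lambda(x|c)=\frac{\det\big[x_i^{1/2}(x_i|c)^{\lambda_j+n-j}-\overline{x}_i^{1/2}(\overline{x}_i|c)^{\lambda_j+n-j}\big]_{i,j=1}^n}{\det\big[x_i^{1/2}(x_i|c)^{n-j}-\overline{x}_i^{1/2}(\overline{x}_i|c)^{n-j}\big]_{i,j=1}^n}$$ is nonzero, and $$\mathrm{so}_\lambda(x|c)=\det\Big[h_{\lambda_i-i+j}(x,\overline{x},1|\tau^{-n-j}c)-h_{\lambda_i-i-j}(x,\overline{x},1|\tau^{-n+j}c)\Big]_{i,j=1}^n,$$ where $h_k(x,\overline{x},1|\cdot)$ is the complete factorial symmetric polynomial in $2n+1$ variables evaluated at $x_1,\dots,x_n,\overline{x}_1,\dots,\overline{x}_n,1$. -/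

import Mathlib

namespace FactorialCharacters

open Finset

/-- The factorial power `(x | c)^k = (x - c_0) ⋯ (x - c_{k-1})`. -/
def factorialPower {R : Type*} [CommRing R] (x : R) (c : ℤ → R) (k : ℕ) : R :=
  ∏ l ∈ range k, (x - c (l : ℤ))

/-- The shift operator `(τ^r c)_m = c_{m + r}`. -/
def shift {R : Type*} (r : ℤ) (c : ℤ → R) : ℤ → R := fun m => c (m + r)

/-- The type A alternant `det [(X_i | c)^{λ_j + N - j}]`, `1 ≤ i, j ≤ N`, a polynomial in
`X_1, …, X_N`. For `j : Fin N` (which stands for the index `j + 1`) the number `N - (j + 1)`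
is the value of `j.rev`. -/
noncomputable def alternant {K : Type*} [Field K] {N : ℕ} (c : ℤ → K) (lam : Fin N → ℕ) :
    MvPolynomial (Fin N) K :=
  Matrix.det (Matrix.of fun i j : Fin N =>
    factorialPower (MvPolynomial.X i) (fun m => MvPolynomial.C (c m)) (lam j + (j.rev : ℕ)))

/-- The polynomial `(T - c_0) ⋯ (T - c_{k-1})` in one variable `T`. -/
noncomputable def factorialPoly {R : Type*} [CommRing R] (c : ℤ → R) (k : ℕ) : Polynomial R :=
  ∏ l ∈ range k, (Polynomial.X - Polynomial.C (c (l : ℤ)))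

theorem eval_factorialPoly {R : Type*} [CommRing R] (c : ℤ → R) (k : ℕ) (x : R) :
    (factorialPoly c k).eval x = factorialPower x c k := by
  simp [factorialPoly, factorialPower, Polynomial.eval_prod]

theorem vandermonde_dvd_det {R : Type*} [CommRing R] :
    ∀ {N : ℕ} (x : Fin N → R) (p : Fin N → Polynomial R),
      (Matrix.vandermonde x).det ∣ (Matrix.of fun i j => (p j).eval (x i)).det := by
  intro N
  induction N with
  | zero => intro x p; simp
  | succ N ih =>
    intro x p
    choose q hq using fun j => Polynomial.X_sub_C_dvd_sub_C_eval (p := p j) (a := x 0)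
    have hq' : ∀ j a, (p j).eval a = (a - x 0) * (q j).eval a + (p j).eval (x 0) := by
      intro j a
      have h := congrArg (Polynomial.eval a) (hq j)
      simp only [Polynomial.eval_sub, Polynomial.eval_C, Polynomial.eval_mul,
        Polynomial.eval_X] at h
      rw [← h]; ring
    let v : Fin (N + 1) → R := Fin.cons 1 (fun i => x i.succ - x 0)
    let B : Matrix (Fin (N + 1)) (Fin (N + 1)) R :=
      Matrix.of fun i j => Fin.cases ((p j).eval (x 0)) (fun i' => (q j).eval (x i'.succ)) i
    have hdet : (Matrix.of fun i j => (p j).eval (x i)).det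
        = (∏ i : Fin N, (x i.succ - x 0)) * B.det := by
      have h1 : (∏ i : Fin N, (x i.succ - x 0)) = ∏ i, v i := by
        simp [v, Fin.prod_univ_succ]
      rw [h1, ← Matrix.det_mul_column v B]
      refine Matrix.det_eq_of_forall_row_eq_smul_add_const (Fin.cons 0 (fun _ => 1)) 0 rfl ?_
      intro i j
      refine Fin.cases ?_ (fun i' => ?_) i
      · simp [v, B]
      · simp [v, B, hq' j (x i'.succ)]
    have hv : (Matrix.vandermonde x).det
        = (∏ i : Fin N, (x i.succ - x 0)) * (Matrix.vandermonde (fun i : Fin N => x i.succ)).det := by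
      rw [Matrix.det_vandermonde, Matrix.det_vandermonde, Fin.prod_univ_succ]
      congr 1
      · rw [Fin.prod_Ioi_zero]
      · exact Finset.prod_congr rfl fun i _ => by rw [Fin.prod_Ioi_succ]
    rw [hdet, hv]
    refine mul_dvd_mul_left _ ?_
    rw [Matrix.det_succ_row_zero]
    refine Finset.dvd_sum fun j _ => Dvd.dvd.mul_left ?_ _
    exact ih (fun i => x i.succ) (fun j' => q (j.succAbove j'))

theorem det_factorialPoly {R : Type*} [CommRing R] [Nontrivial R] {N : ℕ} (x : Fin N → R)
    (c : ℤ → R) :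
    (Matrix.of fun i j : Fin N => factorialPower (x i) c (j : ℕ)).det
      = (Matrix.vandermonde x).det := by
  have hd : ∀ k, (factorialPoly c k).natDegree = k := fun k => by
    simp [factorialPoly]
  rw [Matrix.det_eval_matrixOfPolynomials_eq_det_vandermonde x
    (fun j : Fin N => factorialPoly c (j : ℕ)) (fun j => hd j)
    (fun j => Polynomial.monic_prod_of_monic _ _ fun i _ => Polynomial.monic_X_sub_C _)]
  simp only [eval_factorialPoly]

theorem alternant_zero {K : Type*} [Field K] {N : ℕ} (c : ℤ → K) :
    alternant c (0 : Fin N → ℕ)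
      = ((Equiv.Perm.sign (Fin.revPerm (n := N)) : ℤ) : MvPolynomial (Fin N) K)
        * (Matrix.vandermonde (MvPolynomial.X : Fin N → MvPolynomial (Fin N) K)).det := by
  rw [← det_factorialPoly MvPolynomial.X (fun m => MvPolynomial.C (c m)), ← Matrix.det_permute']
  simp [alternant, Matrix.submatrix]

theorem alternant_zero_ne_zero {K : Type*} [Field K] {N : ℕ} (c : ℤ → K) :
    alternant c (0 : Fin N → ℕ) ≠ 0 := by
  rw [alternant_zero]
  refine mul_ne_zero ?_ (Matrix.det_vandermonde_ne_zero_iff.mpr MvPolynomial.X_injective)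
  rcases Int.units_eq_one_or (Equiv.Perm.sign (Fin.revPerm (n := N))) with h | h <;> simp [h]

theorem alternant_zero_dvd {K : Type*} [Field K] {N : ℕ} (c : ℤ → K) (lam : Fin N → ℕ) :
    alternant c (0 : Fin N → ℕ) ∣ alternant c lam := by
  have h := vandermonde_dvd_det (MvPolynomial.X : Fin N → MvPolynomial (Fin N) K)
    (fun j => factorialPoly (fun m => MvPolynomial.C (c m)) (lam j + (j.rev : ℕ)))
  simp only [eval_factorialPoly] at h
  rw [alternant_zero]
  rcases Int.units_eq_one_or (Equiv.Perm.sign (Fin.revPerm (n := N))) with hs | hs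
  · simpa [hs, alternant] using h
  · simpa [hs, alternant] using h

/-- The factorial Schur polynomial `s_λ(X_1, …, X_N | c)`: the quotient
`det [(X_i | c)^{λ_j + N - j}] / det [(X_i | c)^{N - j}]`, which is a polynomial. -/
noncomputable def factorialSchur {K : Type*} [Field K] {N : ℕ} (c : ℤ → K) (lam : Fin N → ℕ) :
    MvPolynomial (Fin N) K :=
  (alternant_zero_dvd c lam).choose

theorem alternant_zero_mul_factorialSchur {K : Type*} [Field K] {N : ℕ} (c : ℤ → K)
    (lam : Fin N → ℕ) :
    alternant c (0 : Fin N → ℕ) * factorialSchur c lam = alternant c lam :=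
  (alternant_zero_dvd c lam).choose_spec.symm

theorem factorialSchur_unique {K : Type*} [Field K] {N : ℕ} (c : ℤ → K) (lam : Fin N → ℕ)
    (P : MvPolynomial (Fin N) K)
    (hP : alternant c (0 : Fin N → ℕ) * P = alternant c lam) : P = factorialSchur c lam :=
  mul_left_cancel₀ (alternant_zero_ne_zero c)
    (hP.trans (alternant_zero_mul_factorialSchur c lam).symm)

/-- The complete factorial symmetric polynomial `h_k(X_0, …, X_N | c) = s_{(k, 0, …, 0)}(X | c)`
in `N + 1` variables, for an integer `k`; it is `0` for `k < 0`. -/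
noncomputable def completeFactorial {K : Type*} [Field K] {N : ℕ} (k : ℤ) (c : ℤ → K) :
    MvPolynomial (Fin (N + 1)) K :=
  if k < 0 then 0 else factorialSchur c (Pi.single 0 k.toNat)

/-- The `2n + 1` values `x_1, …, x_n, x_1⁻¹, …, x_n⁻¹, 1`. -/
def oddOrthogonalPoint {K : Type*} [Field K] {n : ℕ} (x : Fin n → K) : Fin (n + n + 1) → K :=
  Fin.snoc (α := fun _ => K) (Fin.append x (fun i => (x i)⁻¹)) 1

/-- The value `h_k(x, x̄, 1 | c)` of the complete factorial symmetric polynomial in `2n + 1`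
variables at `(x_1, …, x_n, x_1⁻¹, …, x_n⁻¹, 1)`. -/
noncomputable def hOdd {K : Type*} [Field K] {n : ℕ} (k : ℤ) (x : Fin n → K) (c : ℤ → K) : K :=
  MvPolynomial.eval (oddOrthogonalPoint x) (completeFactorial k c)

/-- The type B alternant
`det [x_i^{1/2} (x_i | c)^{λ_j + n - j} - x_i^{-1/2} (x_i⁻¹ | c)^{λ_j + n - j}]`,
`1 ≤ i, j ≤ n`, where `r i = x_i^{1/2}` and `x_i = (r i)^2`. -/
noncomputable def oddOrthogonalAlternant {K : Type*} [Field K] {n : ℕ} (r : Fin n → K)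
    (c : ℤ → K) (lam : Fin n → ℕ) : K :=
  Matrix.det (Matrix.of fun i j : Fin n =>
    r i * factorialPower (r i ^ 2) c (lam j + (j.rev : ℕ))
      - (r i)⁻¹ * factorialPower (r i ^ 2)⁻¹ c (lam j + (j.rev : ℕ)))

/-- The factorial odd orthogonal character `so_λ(x | c)` at `x_i = (r i)^2`. -/
noncomputable def oddOrthogonalCharacter {K : Type*} [Field K] {n : ℕ} (r : Fin n → K)
    (c : ℤ → K) (lam : Fin n → ℕ) : K :=
  oddOrthogonalAlternant r c lam / oddOrthogonalAlternant r c (0 : Fin n → ℕ)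

end FactorialCharacters

/-! Let `D f` be the `X ^ (2n)` coefficient of the remainder of `f` modulo the polynomial with roots
`x, x⁻¹, 1`. Then `h_k(x, x⁻¹, 1 | a) = D ((X | a)^(k + 2n))` (`eval_completeFactorial`);
remainders, unlike divided difference quotients, tolerate a double node `x_i = -1`. As `c` vanishes
at negative indices, powers of `X` absorb the shifts, and entry `(i, j)` is `D ((X^(n+j) - X^(n-j))
P)` with `P = (X | c)^(λ_i + n - i)`. For fixed `j` this functional of `P` vanishes on the common
kernel of the `n` functionals defining the alternant (`remainderCoeff_eq_zero_of_symmetric`), so it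
is a combination of them. Hence the determinant is `A_λ * det B`, where `A_λ` is the alternant and
`B` does not depend on `λ`. For `λ = 0` the matrix is unitriangular, so `A_0 * det B = 1`: this
gives both `A_0 ≠ 0` and the formula. -/

namespace FactorialCharacters

open Finset Polynomial

/-! ### Top remainder coefficients and expansion in factorial powers. -/

section RemainderCoefficient

variable {R : Type*} [CommRing R]

/-- The coefficient of `X ^ d` in the remainder of a polynomial modulo `w`. For
`w = ∏ i, (X - C (y i))` of degree `d + 1` it is the divided difference at the nodes `y`. -/
noncomputable def remainderCoeff (w : R[X]) (d : ℕ) : R[X] →ₗ[R] R :=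
  (lcoeff R d).comp (modByMonicHom w)

theorem remainderCoeff_apply (w : R[X]) (d : ℕ) (f : R[X]) :
    remainderCoeff w d f = (f %ₘ w).coeff d := rfl

theorem remainderCoeff_of_dvd {w : R[X]} (hw : w.Monic) (d : ℕ) {f : R[X]} (h : w ∣ f) :
    remainderCoeff w d f = 0 := by
  rw [remainderCoeff_apply, (modByMonic_eq_zero_iff_dvd hw).2 h, coeff_zero]

theorem remainderCoeff_of_natDegree_le [Nontrivial R] {w : R[X]} (hw : w.Monic) {d : ℕ}
    (hd : w.natDegree = d + 1) {f : R[X]} (hf : f.natDegree ≤ d) :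
    remainderCoeff w d f = f.coeff d := by
  rw [remainderCoeff_apply, (modByMonic_eq_self_iff hw).2]
  rw [degree_eq_natDegree hw.ne_zero, hd]
  exact lt_of_le_of_lt degree_le_natDegree (by exact_mod_cast Nat.lt_succ_of_le hf)

theorem map_remainderCoeff {S : Type*} [CommRing S] (φ : R →+* S) {w : R[X]} (hw : w.Monic)
    (d : ℕ) (f : R[X]) :
    φ (remainderCoeff w d f) = remainderCoeff (w.map φ) d (f.map φ) := by
  rw [remainderCoeff_apply, remainderCoeff_apply, ← map_modByMonic φ hw, coeff_map]

/-- The monic polynomial with the roots `y i`. -/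
noncomputable def nodePoly {ι : Type*} [Fintype ι] (y : ι → R) : R[X] := ∏ i, (X - C (y i))

theorem nodePoly_monic {ι : Type*} [Fintype ι] (y : ι → R) : (nodePoly y).Monic :=
  monic_prod_of_monic _ _ fun _ _ => monic_X_sub_C _

theorem natDegree_nodePoly [Nontrivial R] {ι : Type*} [Fintype ι] (y : ι → R) :
    (nodePoly y).natDegree = Fintype.card ι := by
  simp [nodePoly]

theorem eval_nodePoly {ι : Type*} [Fintype ι] (y : ι → R) (i : ι) :
    (nodePoly y).eval (y i) = 0 := by
  rw [nodePoly, eval_prod]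
  exact Finset.prod_eq_zero (Finset.mem_univ i) (by simp)

theorem eval_modByMonic_nodePoly {ι : Type*} [Fintype ι] (y : ι → R) (f : R[X]) (i : ι) :
    (f %ₘ nodePoly y).eval (y i) = f.eval (y i) := by
  conv_rhs => rw [← modByMonic_add_div f (nodePoly y)]
  simp [eval_nodePoly]

theorem map_nodePoly {S : Type*} [CommRing S] (φ : R →+* S) {ι : Type*} [Fintype ι] (y : ι → R) :
    (nodePoly y).map φ = nodePoly fun i => φ (y i) := by
  simp [nodePoly, Polynomial.map_prod]

theorem factorialPoly_monic (c : ℤ → R) (k : ℕ) : (factorialPoly c k).Monic :=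
  monic_prod_of_monic _ _ fun _ _ => monic_X_sub_C _

theorem natDegree_factorialPoly [Nontrivial R] (c : ℤ → R) (k : ℕ) :
    (factorialPoly c k).natDegree = k := by
  simp [factorialPoly]

theorem map_factorialPoly {S : Type*} [CommRing S] (φ : R →+* S) (c : ℤ → R) (k : ℕ) :
    (factorialPoly c k).map φ = factorialPoly (fun m => φ (c m)) k := by
  simp [factorialPoly, Polynomial.map_prod]

theorem exists_eq_sum_factorialPoly [Nontrivial R] (c : ℤ → R) (N : ℕ) :
    ∀ f : R[X], f.natDegree ≤ N → ∃ a : ℕ → R, a N = f.coeff N ∧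
      f = ∑ k ∈ range (N + 1), C (a k) * factorialPoly c k := by
  induction N with
  | zero =>
    intro f hf
    refine ⟨fun _ => f.coeff 0, rfl, ?_⟩
    simpa [factorialPoly] using eq_C_of_natDegree_le_zero hf
  | succ N ih =>
    intro f hf
    have hdeg : (f - C (f.coeff (N + 1)) * factorialPoly c (N + 1)).natDegree ≤ N := by
      rw [natDegree_le_iff_coeff_eq_zero]
      intro m hm
      rcases eq_or_lt_of_le (Nat.succ_le_of_lt hm) with h | h
      · subst h
        have h1 : (factorialPoly c (N + 1)).coeff (N + 1) = 1 := by
          simpa [natDegree_factorialPoly] using (factorialPoly_monic c (N + 1)).coeff_natDegree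
        simp [h1]
      · rw [coeff_sub, coeff_C_mul, coeff_eq_zero_of_natDegree_lt (lt_of_le_of_lt hf h),
          coeff_eq_zero_of_natDegree_lt (p := factorialPoly c (N + 1))
            (by rwa [natDegree_factorialPoly]), mul_zero, sub_zero]
    obtain ⟨a, -, ha⟩ := ih _ hdeg
    refine ⟨fun k => if k = N + 1 then f.coeff (N + 1) else a k, by simp, ?_⟩
    rw [Finset.sum_range_succ]
    beta_reduce
    rw [if_pos rfl, ← sub_eq_iff_eq_add, ha]
    refine Finset.sum_congr rfl fun k hk => ?_
    rw [if_neg (Finset.mem_range.1 hk).ne]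

end RemainderCoefficient

/-! ### Complete factorial polynomials as remainder coefficients. -/

section CompleteFactorial

variable {K : Type*} [Field K] {N : ℕ}

/-- Cramer's rule: at the nodes, `(X | c)^(k + N)` agrees with its remainder, a combination of the
columns of the alternant of `0`. The quotient of alternants is the coefficient of the leading
column, which is the top coefficient of the remainder. -/
theorem completeFactorial_natCast (k : ℕ) (c : ℤ → K) :
    (completeFactorial k c : MvPolynomial (Fin (N + 1)) K) =
      remainderCoeff (nodePoly MvPolynomial.X) N
        (factorialPoly (fun m => MvPolynomial.C (c m)) (k + N)) := by
  rw [completeFactorial, if_neg (by simp), Int.toNat_natCast]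
  refine (factorialSchur_unique c _ _ ?_).symm
  set y : Fin (N + 1) → MvPolynomial (Fin (N + 1)) K := MvPolynomial.X
  set c' : ℤ → MvPolynomial (Fin (N + 1)) K := fun m => MvPolynomial.C (c m)
  set f := factorialPoly c' (k + N) with hf
  have hdeg : (f %ₘ nodePoly y).natDegree ≤ N := by
    have h := natDegree_modByMonic_lt f (nodePoly_monic y) (fun h => by
      simpa [h] using natDegree_nodePoly y)
    rw [natDegree_nodePoly, Fintype.card_fin] at h
    exact Nat.le_of_lt_succ h
  obtain ⟨a, haN, ha⟩ := exists_eq_sum_factorialPoly c' N _ hdeg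
  have hval : ∀ i, factorialPower (y i) c' (k + N) =
      ∑ j : Fin (N + 1), a (j.rev : ℕ) • factorialPower (y i) c' (j.rev : ℕ) := by
    intro i
    rw [← eval_factorialPoly, ← hf, ← eval_modByMonic_nodePoly, ha, eval_finsetSum,
      Finset.sum_range, ← Equiv.sum_comp Fin.revPerm]
    simp [eval_factorialPoly]
  have h := Matrix.det_updateCol_sum
    (Matrix.of fun i j : Fin (N + 1) => factorialPower (y i) c' (j.rev : ℕ)) 0
    fun j => a (j.rev : ℕ)
  rw [remainderCoeff_apply, ← haN]
  simp only [alternant]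
  rw [mul_comm]
  convert! h.symm using 1
  · rw [smul_eq_mul, Fin.rev_zero, Fin.val_last]
    simp [y, c']
  · congr 1
    ext i j : 1
    refine Fin.cases ?_ (fun j => ?_) j
    · simpa [Matrix.updateCol_apply, y, c'] using hval i
    · simp [y, c']

theorem eval_completeFactorial (y : Fin (N + 1) → K) (c : ℤ → K) (k : ℤ) (e : ℕ)
    (he : (e : ℤ) = k + N) :
    MvPolynomial.eval y (completeFactorial k c) =
      remainderCoeff (nodePoly y) N (factorialPoly c e) := by
  rcases lt_or_ge k 0 with hk | hk
  -- Here `e < N`, so the coefficient vanishes, in accord with `h_k = 0` for `k < 0`.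
  · rw [completeFactorial, if_pos hk, map_zero,
      remainderCoeff_of_natDegree_le (nodePoly_monic y) (by simp [natDegree_nodePoly])
        (by rw [natDegree_factorialPoly]; omega),
      coeff_eq_zero_of_natDegree_lt (by rw [natDegree_factorialPoly]; omega)]
  · lift k to ℕ using hk
    obtain rfl : e = k + N := by omega
    rw [completeFactorial_natCast, map_remainderCoeff _ (nodePoly_monic _), map_nodePoly,
      map_factorialPoly]
    simp

end CompleteFactorial

/-! ### Congruences modulo `(X - a) (X - a⁻¹)`. -/

section ReciprocalPairs

variable {K : Type*} [Field K]

/-- The quadratic polynomial `(X - a) (X - a⁻¹)` with `a + a⁻¹ = s`. -/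
noncomputable def pairPoly (s : K) : K[X] := X ^ 2 - C s * X + 1

theorem pairPoly_add_inv {a : K} (ha : a ≠ 0) :
    pairPoly (a + a⁻¹) = (X - C a) * (X - C a⁻¹) := by
  have h : C a * C a⁻¹ = (1 : K[X]) := by rw [← C_mul, mul_inv_cancel₀ ha, C_1]
  rw [pairPoly, C_add]
  linear_combination -h

theorem natDegree_pairPoly (s : K) : (pairPoly s).natDegree = 2 := by
  rw [pairPoly]; compute_degree!

theorem pairPoly_monic (s : K) : (pairPoly s).Monic := by
  rw [pairPoly]; monicity!

/-- The difference of the two is `(t - s) X`, and `X` is a unit modulo `pairPoly t`, with inverse `t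
- X`. -/
theorem isCoprime_pairPoly {s t : K} (h : s ≠ t) : IsCoprime (pairPoly s) (pairPoly t) := by
  have hu : C (t - s)⁻¹ * (C t - C s) = (1 : K[X]) := by
    rw [← C_sub, ← C_mul, inv_mul_cancel₀ (sub_ne_zero.2 h.symm), C_1]
  refine ⟨-((X - C t) * C (t - s)⁻¹), 1 + (X - C t) * C (t - s)⁻¹, ?_⟩
  simp only [pairPoly]
  linear_combination -((X - C t) * X) * hu

/-- Modulo `(X - a) (X - a⁻¹)` the polynomial `(X + 1) P` is constant if `a P(a) = P(a⁻¹)`. -/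
theorem exists_pairPoly_dvd_X_add_one_mul_sub_C {a : K} (ha : a ≠ 0) (ha1 : a ≠ 1) {P : K[X]}
    (hP : a * P.eval a = P.eval a⁻¹) :
    ∃ v : K, pairPoly (a + a⁻¹) ∣ (X + 1) * P - C v := by
  set q := pairPoly (a + a⁻¹) with hq
  have hdeg : (P %ₘ q).natDegree ≤ 1 := by
    have h := natDegree_modByMonic_lt P (pairPoly_monic (a + a⁻¹)) (fun h => by
      simpa [h] using natDegree_pairPoly (a + a⁻¹))
    rw [natDegree_pairPoly] at h
    exact Nat.le_of_lt_succ h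
  obtain ⟨β, α, hαβ⟩ := exists_eq_X_add_C_of_natDegree_le_one hdeg
  have hPq : P = C β * X + C α + q * (P /ₘ q) := by rw [← hαβ, modByMonic_add_div]
  have h1 : P.eval a = β * a + α := by
    rw [hPq, hq, pairPoly_add_inv ha]; simp
  have h2 : P.eval a⁻¹ = β * a⁻¹ + α := by
    rw [hPq, hq, pairPoly_add_inv ha]; simp
  -- The symmetry determines the linear remainder up to scale; `a ≠ 1` is needed to cancel `a - 1`.
  have hα : α = -(β * (a + a⁻¹ + 1)) := by
    rw [h1, h2] at hP
    have ha1' : a - 1 ≠ 0 := sub_ne_zero.2 ha1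
    refine mul_left_cancel₀ ha1' ?_
    have : a * a⁻¹ = 1 := mul_inv_cancel₀ ha
    linear_combination hP + β * this
  refine ⟨α - β, (X + 1) * (P /ₘ q) + C β, ?_⟩
  have hα' : C α = -(C β * (C (a + a⁻¹) + 1)) := by
    rw [hα]; simp
  rw [C_sub]
  have hq' : q = X ^ 2 - C (a + a⁻¹) * X + 1 := rfl
  linear_combination (X + 1) * hPq + X * hα' - C β * hq'

/-- Divided by `X ^ j` the sum is invariant under `X ↦ X⁻¹`, hence a polynomial in `s`: a rescaled
Chebyshev polynomial of the second kind, with `u_{j+2} = s u_{j+1} - u_j`. -/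
theorem exists_pairPoly_dvd_geom_sum_sub (s : K) (j : ℕ) :
    ∃ u : K, pairPoly s ∣ ∑ m ∈ range (j + 1), (X ^ 2) ^ m - C u * X ^ j := by
  induction j using Nat.twoStepInduction with
  | zero => exact ⟨1, by simp⟩
  | one =>
    refine ⟨s, 1, ?_⟩
    simp [Finset.sum_range_succ, pairPoly]
    ring
  | more j ih0 ih1 =>
    obtain ⟨u, a, ha⟩ := ih0
    obtain ⟨v, b, hb⟩ := ih1
    refine ⟨s * v - u, (1 + X ^ 2) * b - X ^ 2 * a + C v * X ^ (j + 1), ?_⟩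
    have e1 : ∑ m ∈ range (j + 2 + 1), ((X : K[X]) ^ 2) ^ m =
        X ^ 2 * ∑ m ∈ range (j + 1 + 1), (X ^ 2) ^ m + 1 := geom_sum_succ
    have e2 : ∑ m ∈ range (j + 1 + 1), ((X : K[X]) ^ 2) ^ m =
        X ^ 2 * ∑ m ∈ range (j + 1), (X ^ 2) ^ m + 1 := geom_sum_succ
    rw [C_sub, C_mul]
    simp only [pairPoly] at *
    linear_combination (1 + X ^ 2) * hb - X ^ 2 * ha + e1 - e2

theorem exists_pairPoly_dvd_sub_eval (n : ℕ) (S : K[X]) (hS : S.degree < n) :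
    ∃ T : K[X], T.natDegree ≤ 2 * (n - 1) ∧
      ∀ s : K, pairPoly s ∣ T - C (S.eval s) * X ^ (n - 1) := by
  -- This is `X^(n-1) S(X + X⁻¹)`; modulo `pairPoly s`, `X ^ 2 + 1` becomes `s X`.
  refine ⟨∑ m ∈ range n, C (S.coeff m) * (X ^ (n - 1 - m) * (X ^ 2 + 1) ^ m), ?_, fun s => ?_⟩
  · refine natDegree_sum_le_of_forall_le _ _ fun m hm => ?_
    have hm' := Finset.mem_range.1 hm
    have : (C (S.coeff m) * (X ^ (n - 1 - m) * (X ^ 2 + 1) ^ m)).natDegree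
        ≤ n - 1 - m + m * 2 := by compute_degree
    omega
  · have hev : S.eval s = ∑ m ∈ range n, S.coeff m * s ^ m := by
      rcases eq_or_ne S 0 with h | h
      · simp [h]
      · exact eval_eq_sum_range' ((natDegree_lt_iff_degree_lt h).2 hS) s
    rw [hev, map_sum, Finset.sum_mul, ← Finset.sum_sub_distrib]
    refine Finset.dvd_sum fun m hm => ?_
    have hm' := Finset.mem_range.1 hm
    have hd : pairPoly s ∣ (X ^ 2 + 1) ^ m - (C s * X) ^ m := by
      have h := sub_dvd_pow_sub_pow ((X : K[X]) ^ 2 + 1) (C s * X) m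
      have e : pairPoly s = (X ^ 2 + 1) - C s * X := by rw [pairPoly]; ring
      rwa [e]
    have e : C (S.coeff m) * (X ^ (n - 1 - m) * (X ^ 2 + 1) ^ m) -
        C (S.coeff m * s ^ m) * X ^ (n - 1) =
        (C (S.coeff m) * X ^ (n - 1 - m)) * ((X ^ 2 + 1) ^ m - (C s * X) ^ m) := by
      have hp : (X : K[X]) ^ (n - 1) = X ^ (n - 1 - m) * X ^ m := by
        rw [← pow_add]; congr 1; omega
      rw [hp, C_mul, C_pow, mul_pow]; ring
    rw [e]
    exact Dvd.dvd.mul_left hd _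

theorem nodePoly_oddOrthogonalPoint {n : ℕ} {x : Fin n → K} (hx0 : ∀ i, x i ≠ 0) :
    nodePoly (oddOrthogonalPoint x) = (∏ i, pairPoly (x i + (x i)⁻¹)) * (X - 1) := by
  rw [nodePoly, Fin.prod_univ_castSucc, Fin.prod_univ_add]
  simp only [oddOrthogonalPoint, Fin.snoc_castSucc, Fin.snoc_last, Fin.append_left,
    Fin.append_right, pairPoly_add_inv (hx0 _), Finset.prod_mul_distrib, C_1]

theorem add_inv_ne_add_inv {a b : K} (ha : a ≠ 0) (hb : b ≠ 0) (h1 : a ≠ b) (h2 : a ≠ b⁻¹) :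
    a + a⁻¹ ≠ b + b⁻¹ := by
  intro h
  have h3 : (a - b) * (a - b⁻¹) = 0 := by
    have e1 := mul_inv_cancel₀ ha
    have e2 := mul_inv_cancel₀ hb
    linear_combination a * h - e1 + e2
  rcases mul_eq_zero.1 h3 with h | h
  · exact h1 (sub_eq_zero.1 h)
  · exact h2 (sub_eq_zero.1 h)

/-- With `X - 1` split off, the product is a constant times `X^(n-1)` modulo each pair.
Interpolating these constants at the distinct `x_i + x_i⁻¹` yields one `T` of degree at most `2n -
2`, so the full remainder `T (X - 1)` misses degree `2n`. -/
theorem remainderCoeff_eq_zero_of_symmetric {n : ℕ} {x : Fin n → K} (hx0 : ∀ i, x i ≠ 0)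
    (hx1 : ∀ i, x i ≠ 1) (hxx : ∀ i j, i ≠ j → x i ≠ x j ∧ x i ≠ (x j)⁻¹) {P : K[X]}
    (hP : ∀ i, x i * P.eval (x i) = P.eval (x i)⁻¹) (j : Fin n) :
    remainderCoeff (nodePoly (oddOrthogonalPoint x)) (n + n)
      ((X ^ (n + (j + 1)) - X ^ (n - (j + 1))) * P) = 0 := by
  have hj := j.isLt
  set s : Fin n → K := fun i => x i + (x i)⁻¹ with hs
  have hsne : ∀ i k, i ≠ k → s i ≠ s k := fun i k hik =>
    add_inv_ne_add_inv (hx0 i) (hx0 k) (hxx i k hik).1 (hxx i k hik).2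
  choose v hv using fun i => exists_pairPoly_dvd_X_add_one_mul_sub_C (hx0 i) (hx1 i) (hP i)
  choose u hu using fun i => exists_pairPoly_dvd_geom_sum_sub (s i) j
  have hinj : Set.InjOn s (univ : Finset (Fin n)) := fun i _ k _ h => by
    by_contra hik; exact hsne i k hik h
  obtain ⟨T, hTdeg, hT⟩ := exists_pairPoly_dvd_sub_eval n
    (Lagrange.interpolate univ s fun i => u i * v i)
    (by simpa using Lagrange.degree_interpolate_lt (fun i => u i * v i) hinj)
  set g : K[X] := ∑ m ∈ range ((j : ℕ) + 1), (X ^ 2) ^ m with hg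
  have hdvd : ∏ i, pairPoly (s i) ∣ X ^ (n - (j + 1)) * g * ((X + 1) * P) - T := by
    refine Finset.prod_dvd_of_coprime (fun i _ k _ hik => isCoprime_pairPoly (hsne i k hik)) ?_
    intro i _
    have h3 := hT (s i)
    rw [Lagrange.eval_interpolate_at_node _ hinj (mem_univ i), C_mul] at h3
    have hp : (X : K[X]) ^ (n - 1) = X ^ (n - (j + 1)) * X ^ (j : ℕ) := by
      rw [← pow_add]; congr 1; omega
    rw [hp] at h3
    have e : X ^ (n - (j + 1)) * g * ((X + 1) * P) - T =
        X ^ (n - (j + 1)) * ((X + 1) * P) * (g - C (u i) * X ^ (j : ℕ))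
        + X ^ (n - (j + 1)) * X ^ (j : ℕ) * C (u i) * ((X + 1) * P - C (v i))
        - (T - C (u i) * C (v i) * (X ^ (n - (j + 1)) * X ^ (j : ℕ))) := by ring
    rw [e]
    exact dvd_sub (dvd_add (Dvd.dvd.mul_left (hu i) _) (Dvd.dvd.mul_left (hv i) _)) h3
  have hgeom : (X : K[X]) ^ (n + (j + 1)) - X ^ (n - (j + 1)) =
      (X - 1) * (X + 1) * (X ^ (n - (j + 1)) * g) := by
    have h1 : g * ((X : K[X]) ^ 2 - 1) = (X ^ 2) ^ ((j : ℕ) + 1) - 1 := geom_sum_mul _ _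
    have h2 : (X : K[X]) ^ (n + (j + 1)) = X ^ (n - (j + 1)) * (X ^ 2) ^ ((j : ℕ) + 1) := by
      rw [← pow_mul, ← pow_add]; congr 1; omega
    rw [h2]
    linear_combination -(X : K[X]) ^ (n - (j + 1)) * h1
  have hdvd' : nodePoly (oddOrthogonalPoint x) ∣
      (X ^ (n + (j + 1)) - X ^ (n - (j + 1))) * P - T * (X - 1) := by
    rw [nodePoly_oddOrthogonalPoint hx0]
    have e : (X ^ (n + (j + 1)) - X ^ (n - (j + 1))) * P - T * (X - 1) =
        (X ^ (n - (j + 1)) * g * ((X + 1) * P) - T) * (X - 1) := by rw [hgeom]; ring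
    rw [e]
    exact mul_dvd_mul_right hdvd _
  have hmonic := nodePoly_monic (oddOrthogonalPoint x)
  have h0 := remainderCoeff_of_dvd hmonic (n + n) hdvd'
  have hTdeg' : (T * (X - 1)).natDegree < n + n := by
    have h1 : (X - 1 : K[X]).natDegree ≤ 1 := by compute_degree
    have h2 := natDegree_mul_le (p := T) (q := X - 1)
    omega
  rw [map_sub, remainderCoeff_of_natDegree_le hmonic (by simp [natDegree_nodePoly]) hTdeg'.le,
    coeff_eq_zero_of_natDegree_lt hTdeg', sub_zero] at h0
  exact h0

end ReciprocalPairs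

/-! ### Factorization through the alternant. -/

section OddOrthogonal

variable {K : Type*} [Field K] {n : ℕ}

/-- The functional `P ↦ r P(r²) - r⁻¹ P(r⁻²)`. -/
noncomputable def oddEval (r : K) : K[X] →ₗ[K] K :=
  r • leval (r ^ 2) - r⁻¹ • leval (r ^ 2)⁻¹

theorem oddEval_apply (r : K) (P : K[X]) :
    oddEval r P = r * P.eval (r ^ 2) - r⁻¹ * P.eval (r ^ 2)⁻¹ := by
  simp [oddEval, leval]

theorem oddEval_eq_zero_iff {r : K} (hr : r ≠ 0) (P : K[X]) :
    oddEval r P = 0 ↔ r ^ 2 * P.eval (r ^ 2) = P.eval (r ^ 2)⁻¹ := by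
  rw [oddEval_apply, sub_eq_zero, eq_inv_mul_iff_mul_eq₀ hr, ← mul_assoc, ← pow_two]

theorem exists_remainderCoeff_eq_sum_oddEval {r : Fin n → K} (hr0 : ∀ i, r i ^ 2 ≠ 0)
    (hr1 : ∀ i, r i ^ 2 ≠ 1) (hrr : ∀ i j, i ≠ j → r i ^ 2 ≠ r j ^ 2 ∧ r i ^ 2 ≠ (r j ^ 2)⁻¹) :
    ∃ B : Matrix (Fin n) (Fin n) K, ∀ (P : K[X]) (j : Fin n),
      remainderCoeff (nodePoly (oddOrthogonalPoint fun i => r i ^ 2)) (n + n)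
        ((X ^ (n + (j + 1)) - X ^ (n - (j + 1))) * P) = ∑ k, oddEval (r k) P * B k j := by
  have h : ∀ j : Fin n, ∃ b : Fin n → K, ∑ k, b k • oddEval (r k) =
      (remainderCoeff (nodePoly (oddOrthogonalPoint fun i => r i ^ 2)) (n + n)).comp
        (LinearMap.mulLeft K (X ^ (n + (j + 1)) - X ^ (n - (j + 1)) : K[X])) := by
    intro j
    -- A functional vanishing on the common kernel of finitely many others lies in their span.
    refine (Submodule.mem_span_range_iff_exists_fun K).1 (mem_span_of_iInf_ker_le_ker ?_)
    intro P hP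
    simp only [Submodule.mem_iInf, LinearMap.mem_ker] at hP ⊢
    exact remainderCoeff_eq_zero_of_symmetric hr0 hr1 hrr
      (fun i => (oddEval_eq_zero_iff (fun h => hr0 i (by simp [h])) P).1 (hP i)) j
  choose b hb using h
  refine ⟨Matrix.of fun k j => b j k, fun P j => ?_⟩
  have := LinearMap.congr_fun (hb j) P
  simp only [LinearMap.comp_apply, LinearMap.mulLeft_apply, LinearMap.sum_apply,
    LinearMap.smul_apply, smul_eq_mul] at this
  rw [← this]
  exact Finset.sum_congr rfl fun k _ => mul_comm _ _

/-- The first `a` factors of the shifted power involve `c` only at negative indices, so each is `X`.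
-/
theorem X_pow_mul_factorialPoly {c : ℤ → K} (hc : ∀ m : ℤ, m < 0 → c m = 0) (a e : ℕ) :
    X ^ a * factorialPoly c e = factorialPoly (shift (-(a : ℤ)) c) (a + e) := by
  rw [factorialPoly, factorialPoly, Finset.prod_range_add]
  congr 1
  · rw [← Finset.card_range a, ← Finset.prod_const, Finset.card_range]
    refine Finset.prod_congr rfl fun l hl => ?_
    have := Finset.mem_range.1 hl
    rw [shift, hc _ (by omega), C_0, sub_zero]
  · refine Finset.prod_congr rfl fun l _ => ?_
    rw [shift]
    congr 3
    push_cast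
    ring

theorem oddOrthogonalAlternant_eq_det_oddEval (r : Fin n → K) (c : ℤ → K) (lam : Fin n → ℕ) :
    oddOrthogonalAlternant r c lam =
      (Matrix.of fun i j : Fin n =>
        oddEval (r i) (factorialPoly c (lam j + (j.rev : ℕ)))).det := by
  simp only [oddOrthogonalAlternant, oddEval_apply, eval_factorialPoly]

/-- The matrix whose determinant expresses `so_λ`, in terms of divided differences. -/
noncomputable def jacobiTrudiMatrix (x : Fin n → K) (c : ℤ → K) (lam : Fin n → ℕ) :
    Matrix (Fin n) (Fin n) K :=
  Matrix.of fun i j => remainderCoeff (nodePoly (oddOrthogonalPoint x)) (n + n)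
    ((X ^ (n + ((j : ℕ) + 1)) - X ^ (n - ((j : ℕ) + 1))) *
      factorialPoly c (lam i + (i.rev : ℕ)))

theorem jacobiTrudiMatrix_apply (x : Fin n → K) {c : ℤ → K} (hc : ∀ m : ℤ, m < 0 → c m = 0)
    (lam : Fin n → ℕ) (i j : Fin n) :
    jacobiTrudiMatrix x c lam i j =
      hOdd ((lam i : ℤ) - ((i : ℤ) + 1) + ((j : ℤ) + 1)) x (shift (-(n : ℤ) - ((j : ℤ) + 1)) c)
        - hOdd ((lam i : ℤ) - ((i : ℤ) + 1) - ((j : ℤ) + 1)) x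
            (shift (-(n : ℤ) + ((j : ℤ) + 1)) c) := by
  have hi := i.isLt
  have hj := j.isLt
  rw [hOdd, hOdd, eval_completeFactorial _ _ _ (n + (j + 1) + (lam i + i.rev))
      (by simp only [Fin.val_rev]; omega),
    eval_completeFactorial _ _ _ (n - (j + 1) + (lam i + i.rev))
      (by simp only [Fin.val_rev]; omega),
    jacobiTrudiMatrix, Matrix.of_apply, sub_mul, map_sub, X_pow_mul_factorialPoly hc,
    X_pow_mul_factorialPoly hc]
  congr 4
  · push_cast; ring
  · omega

theorem det_jacobiTrudiMatrix_zero (x : Fin n → K) (c : ℤ → K) :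
    (jacobiTrudiMatrix x c 0).det = 1 := by
  have hentry : ∀ i j : Fin n, j ≤ i →
      jacobiTrudiMatrix x c 0 i j = if i = j then 1 else 0 := by
    intro i j hij
    have hij' : (j : ℕ) ≤ i := hij
    have hi := i.isLt
    have hm : ∀ a : ℕ, (X ^ a * factorialPoly c (i.rev : ℕ)).Monic := fun a =>
      (monic_X_pow a).mul (factorialPoly_monic c _)
    have hd : ∀ a : ℕ, (X ^ a * factorialPoly c (i.rev : ℕ)).natDegree = a + i.rev := fun a => by
      rw [(monic_X_pow a).natDegree_mul (factorialPoly_monic c _), natDegree_X_pow,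
        natDegree_factorialPoly]
    have hw := nodePoly_monic (oddOrthogonalPoint x)
    have hwd : (nodePoly (oddOrthogonalPoint x)).natDegree = n + n + 1 := by
      simp [natDegree_nodePoly]
    have hrev := Fin.val_rev i
    -- The two products are monic of degrees `2n + j - i` and `2n - i - j - 2`. For `j ≤ i` neither
    -- exceeds `2n`, so no reduction occurs, and only the first reaches `2n`, exactly when `i = j`.
    rw [jacobiTrudiMatrix, Matrix.of_apply, Pi.zero_apply, zero_add, sub_mul, map_sub,
      remainderCoeff_of_natDegree_le hw hwd (by rw [hd]; omega),
      remainderCoeff_of_natDegree_le hw hwd (by rw [hd]; omega),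
      coeff_eq_zero_of_natDegree_lt (p := X ^ (n - ((j : ℕ) + 1)) * _) (by rw [hd]; omega),
      sub_zero]
    split_ifs with h
    · subst h
      have h1 := (hm (n + ((i : ℕ) + 1))).coeff_natDegree
      rwa [hd, show n + ((i : ℕ) + 1) + i.rev = n + n by omega] at h1
    · have : (i : ℕ) ≠ j := fun e => h (Fin.ext e)
      exact coeff_eq_zero_of_natDegree_lt (by rw [hd]; omega)
  rw [Matrix.det_of_isUpperTriangular]
  · exact Finset.prod_eq_one fun i _ => by rw [hentry i i le_rfl, if_pos rfl]
  · intro i j hij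
    exact (hentry i j (le_of_lt hij)).trans (if_neg (ne_of_gt hij))

end OddOrthogonal

end FactorialCharacters

/-- Jacobi--Trudi identity for the factorial odd orthogonal characters. The elements
`i j : Fin n` stand for the indices `i + 1` and `j + 1`. -/
theorem mainTheorem7 {K : Type*} [Field K] (n : ℕ) (c : ℤ → K) (hc : ∀ m : ℤ, m < 0 → c m = 0)
    (x r : Fin n → K) (hr : ∀ i, r i ^ 2 = x i)
    (hx0 : ∀ i, x i ≠ 0) (hx1 : ∀ i, x i ≠ 1)
    (hxx : ∀ i j, i ≠ j → x i ≠ x j ∧ x i ≠ (x j)⁻¹)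
    (lam : Fin n → ℕ) (hlam : Antitone lam) :
    FactorialCharacters.oddOrthogonalAlternant r c (0 : Fin n → ℕ) ≠ 0 ∧
    FactorialCharacters.oddOrthogonalCharacter r c lam =
      Matrix.det (Matrix.of fun i j : Fin n =>
        FactorialCharacters.hOdd ((lam i : ℤ) - ((i : ℤ) + 1) + ((j : ℤ) + 1)) x
            (FactorialCharacters.shift (-(n : ℤ) - ((j : ℤ) + 1)) c)
          - FactorialCharacters.hOdd ((lam i : ℤ) - ((i : ℤ) + 1) - ((j : ℤ) + 1)) x
            (FactorialCharacters.shift (-(n : ℤ) + ((j : ℤ) + 1)) c)) := by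
  open FactorialCharacters in
  obtain rfl : x = fun i => r i ^ 2 := funext fun i => (hr i).symm
  obtain ⟨B, hB⟩ := exists_remainderCoeff_eq_sum_oddEval hx0 hx1 hxx
  have hdet : ∀ mu : Fin n → ℕ, (jacobiTrudiMatrix (fun i => r i ^ 2) c mu).det =
      oddOrthogonalAlternant r c mu * B.det := by
    intro mu
    -- The transpose is needed because the partition indexes the columns of the alternant but the
    -- rows of `jacobiTrudiMatrix`.
    rw [oddOrthogonalAlternant_eq_det_oddEval, ← Matrix.det_transpose (Matrix.of _),
      ← Matrix.det_mul]
    congr 1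
    ext i j
    rw [Matrix.mul_apply, jacobiTrudiMatrix, Matrix.of_apply, hB]
    rfl
  have h0 := hdet 0
  rw [det_jacobiTrudiMatrix_zero] at h0
  have hne : oddOrthogonalAlternant r c (0 : Fin n → ℕ) ≠ 0 := left_ne_zero_of_mul_eq_one h0.symm
  refine ⟨hne, ?_⟩
  have hmat : (Matrix.of fun i j : Fin n =>
        hOdd ((lam i : ℤ) - ((i : ℤ) + 1) + ((j : ℤ) + 1)) (fun i => r i ^ 2)
            (shift (-(n : ℤ) - ((j : ℤ) + 1)) c)
          - hOdd ((lam i : ℤ) - ((i : ℤ) + 1) - ((j : ℤ) + 1)) (fun i => r i ^ 2)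
            (shift (-(n : ℤ) + ((j : ℤ) + 1)) c)) =
      jacobiTrudiMatrix (fun i => r i ^ 2) c lam := by
    ext i j
    rw [jacobiTrudiMatrix_apply _ hc]
    rfl
  rw [hmat, hdet, oddOrthogonalCharacter, div_eq_iff hne]
  linear_combination oddOrthogonalAlternant r c lam * h0
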